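/- Let $X$ and $Y$ be discrete random variables with values in the finite sets $\{x_1,\dots,x_r\}$ and $\{y_1,\dots,y_s\}$ (distinct elements), with joint probabilities $p_{i,j}=\mathbb P(X=x_i,Y=y_j)$. Let $K=\{1,\dots,rs\}$, let $z_1,\dots,z_{rs}$ be distinct, and let $Z$ be a random variable associated with the pair in the sense that $p_{Z,\,s(i-1)+j}:=\mathbb P(Z=z_{s(i-1)+j})=p_{i,j}$ for all $1\le i\le r$, $1\le j\le s$. Assume $p_{Z,k}=\mathbb P(Z=z_k)>0$ for all $k\in K$. Let $Z_1,Z_2,\dots$ be i.i.d. copies of $Z$, and put $$\widehat p^{(n)}_{Z,k}=\frac1n\sum_{\ell=1}^n 1_{\{Z_\ell=z_k\}},\qquad \widehat p^{(n)}_{i,j}=\widehat p^{(n)}_{Z,\,s(i-1)+j},\qquad a_{Z,n}=\sup_{k\in K}\bigl|\widehat p^{(n)}_{Z,k}-p_{Z,k}\bigr| .$$ Let $\mathcal E(\mathbf p_{(X,Y)})=-\sum_{i,j}p_{i,j}\log p_{i,j}$ be the joint entropy (natural logarithm) and $\mathcal E(\widehat{\mathbf p}^{(n)}_{(X,Y)})=-\sum_{i,j}\widehat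 p^{(n)}_{i,j}\log\widehat p^{(n)}_{i,j}$ its plug-in estimator (with $0\log 0=0$). Set $$A(\mathbf p_Z)=\sum_{k\in K}\bigl|1+\log p_{Z,k}\bigr|,$$ $$\sigma^2(\mathbf p_Z)=\sum_{k\in K}p_{Z,k}(1-p_{Z,k})(1+\log p_{Z,k})^2-\sum_{(k,k')\in K^2,\;k\ne k'}p_{Z,k}\,p_{Z,k'}\,(1+\log p_{Z,k})(1+\log p_{Z,k'}) .$$ Then, almost surely, $$\limsup_{n\to\infty}\frac{\bigl|\mathcal E(\widehat{\mathbf p}^{(n)}_{(X,Y)})-\mathcal E(\mathbf p_{(X,Y)})\bigr|}{a_{Z,n}}\le A(\mathbf p_Z)$$ (where the ratio is read as $0$ when $a_{Z,n}=0$, in which case its numerator vanishes as well). Moreover $\sigma^2(\mathbf p_Z)\ge 0$ and $$\sqrt n\,\bigl(\mathcal E(\widehat{\mathbf p}^{(n)}_{(X,Y)})-\mathcal E(\mathbf p_{(X,Y)})\bigr)\longrightarrow \mathcal N\bigl(0,\sigma^2(\mathbf p_Z)\bigr)\quad\text{in distribution as } n\to\infty,$$ where $\mathcal N(0,0)$ is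 the point mass at $0$. -/

import Mathlib

open MeasureTheory ProbabilityTheory Filter Topology

/-- The index `δ(i, j)` of the value of the associated variable `Z` that encodes the pair
`(x_i, y_j)`.  With indices counted from `0` it is `s * i + j`, that is `s * (i - 1) + j` when
they are counted from `1`. -/
def pairIndex {r s : ℕ} (i : Fin r) (j : Fin s) : Fin (r * s) := finProdFinEquiv (i, j)

theorem pairIndex_val {r s : ℕ} (i : Fin r) (j : Fin s) :
    (pairIndex i j : ℕ) = s * i + j := by
  simp [pairIndex, finProdFinEquiv, add_comm]

/-- The joint probability mass function `p_{i,j} = P(X = x_i, Y = y_j)`. -/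
noncomputable def jointPMF {Ω 𝒳 𝒴 : Type*} [MeasurableSpace Ω] (P : Measure Ω) {r s : ℕ}
    (x : Fin r → 𝒳) (y : Fin s → 𝒴) (X : Ω → 𝒳) (Y : Ω → 𝒴) (i : Fin r) (j : Fin s) : ℝ :=
  P.real {ω | X ω = x i ∧ Y ω = y j}

/-- The probability mass function `p_{Z,k} = P(Z = z_k)`. -/
noncomputable def valuePMF {Ω 𝒵 : Type*} [MeasurableSpace Ω] (P : Measure Ω) {m : ℕ}
    (z : Fin m → 𝒵) (Z : Ω → 𝒵) (k : Fin m) : ℝ :=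
  P.real {ω | Z ω = z k}

/-- The joint entropy, in nats, of a joint mass function `q`, with `0 log 0 = 0`. -/
noncomputable def jointEntropy {r s : ℕ} (q : Fin r → Fin s → ℝ) : ℝ :=
  -∑ i, ∑ j, q i j * Real.log (q i j)

/-- The empirical frequency `p̂_{Z,k}^{(n)}` of the value `z_k` among the first `n` observations
(which are `Zs 0, …, Zs (n - 1)`). -/
noncomputable def empPMF {Ω 𝒵 : Type*} {m : ℕ} (z : Fin m → 𝒵) (Zs : ℕ → Ω → 𝒵)
    (n : ℕ) (ω : Ω) (k : Fin m) : ℝ :=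
  (1 / (n : ℝ)) * ∑ l ∈ Finset.range n, ({z k} : Set 𝒵).indicator (fun _ => (1 : ℝ)) (Zs l ω)

/-- The plug-in estimator of the joint entropy of the pair, from `p̂_{i,j} = p̂_{Z,δ(i,j)}`. -/
noncomputable def plugInEntropy {Ω 𝒵 : Type*} {r s : ℕ} (z : Fin (r * s) → 𝒵)
    (Zs : ℕ → Ω → 𝒵) (n : ℕ) (ω : Ω) : ℝ :=
  jointEntropy (fun (i : Fin r) (j : Fin s) => empPMF z Zs n ω (pairIndex i j))

/-- The uniform deviation `a_{Z,n} = sup_k |p̂_{Z,k}^{(n)} - p_{Z,k}|`. -/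
noncomputable def supDeviation {Ω 𝒵 : Type*} {m : ℕ} (z : Fin m → 𝒵) (Zs : ℕ → Ω → 𝒵)
    (p : Fin m → ℝ) (n : ℕ) (ω : Ω) : ℝ :=
  ⨆ k, |empPMF z Zs n ω k - p k|

/-- The constant `A(p) = ∑_k |1 + log p_k|`. -/
noncomputable def entropyRateConst {m : ℕ} (p : Fin m → ℝ) : ℝ :=
  ∑ k, |1 + Real.log (p k)|

/-- The asymptotic variance: the diagonal part, minus the sum over all ordered pairs of distinct
indices of `p_k p_{k'} (1 + log p_k) (1 + log p_{k'})`. -/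
noncomputable def entropyVariance {m : ℕ} (p : Fin m → ℝ) : ℝ :=
  ∑ k, p k * (1 - p k) * (1 + Real.log (p k)) ^ 2
    - ∑ kk ∈ (Finset.univ : Finset (Fin m)).offDiag,
        p kk.1 * p kk.2 * (1 + Real.log (p kk.1)) * (1 + Real.log (p kk.2))

/-! Both limits come from one expansion of `h t = -t log t` at `p > 0`, where `h' p = -(1 + log p)`.
Its remainder is at most `(q - p)^2 / p` for every `q ≥ 0`, including `q = 0`, so no localisation
near `p` is needed (`abs_negMulLog_sub_add_le`). Summed over the cells, the entropy error is `-∑ (1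
+ log p_k) (p̂_k - p_k) + R_n` with `|R_n| ≤ ∑ (p̂_k - p_k)^2 / p_k`.

Almost sure bound: dividing by the sup deviation leaves at most `A(p) + ∑ |p̂_k - p_k| / p_k`, and
the last sum tends to `0` by the strong law.

Normal limit: the linear part is a centred i.i.d. average, so the central limit theorem applies, and
its variance is `σ²(p)`, hence `σ²(p) ≥ 0`. Since `E|R_n| = O(1/n)`, Markov's inequality gives `√n
R_n → 0` in probability, and Slutsky's lemma concludes. -/

open Real in
/-- First-order Taylor expansion of `x ↦ -x log x` at `p > 0`, with a quadratic remainder that is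
uniform on `[0, ∞)`. -/
lemma abs_negMulLog_sub_add_le {p q : ℝ} (hp : 0 < p) (hq : 0 ≤ q) :
    |negMulLog q - negMulLog p + (1 + log p) * (q - p)| ≤ (q - p) ^ 2 / p := by
  rcases hq.eq_or_lt with rfl | hq
  · have : negMulLog 0 - negMulLog p + (1 + log p) * (0 - p) = -p := by
      simp only [negMulLog]; ring
    rw [this, abs_neg, abs_of_pos hp]
    apply le_of_eq
    field_simp
    ring
  · have hlog : log (q / p) = log q - log p := log_div hq.ne' hp.ne'
    -- With `t = q / p`, the bounds `1 - 1/t ≤ log t ≤ t - 1` place `q log t - (q - p)` between `0`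
    -- and `(q - p)^2 / p`.
    have h1 : log (q / p) ≤ q / p - 1 := log_le_sub_one_of_pos (div_pos hq hp)
    have h2 : 1 - (q / p)⁻¹ ≤ log (q / p) := one_sub_inv_le_log_of_pos (div_pos hq hp)
    have e : negMulLog q - negMulLog p + (1 + log p) * (q - p) = -(q * log (q / p) - (q - p)) := by
      rw [hlog]; simp only [negMulLog]; ring
    have h3 : q * log (q / p) ≤ q * (q / p - 1) := mul_le_mul_of_nonneg_left h1 hq.le
    have h4 : q * (1 - (q / p)⁻¹) ≤ q * log (q / p) := mul_le_mul_of_nonneg_left h2 hq.le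
    have h5 : q * (q / p - 1) - (q - p) = (q - p) ^ 2 / p := by field_simp
    have h6 : q * (1 - (q / p)⁻¹) = q - p := by field_simp
    rw [e, abs_neg, abs_of_nonneg (by linarith)]
    linarith

lemma jointEntropy_pairIndex {r s : ℕ} (q : Fin (r * s) → ℝ) :
    jointEntropy (fun (i : Fin r) (j : Fin s) => q (pairIndex i j)) =
      ∑ k, Real.negMulLog (q k) := by
  rw [← finProdFinEquiv.sum_comp, Fintype.sum_prod_type]
  simp [jointEntropy, pairIndex, Real.negMulLog]

/-- The asymptotic variance in the form `∑ p c² - (∑ p c)²`. -/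
lemma entropyVariance_eq {m : ℕ} (p : Fin m → ℝ) :
    entropyVariance p = ∑ k, p k * (1 + Real.log (p k)) ^ 2
      - (∑ k, p k * (1 + Real.log (p k))) ^ 2 := by
  -- Expand `(∑ p c)^2` as a double sum: its diagonal turns `p c^2` into `p (1 - p) c^2`. The
  -- identity is algebraic and does not need `∑ p = 1`.
  have h := Finset.sum_product' (Finset.univ : Finset (Fin m)) Finset.univ
    (fun k k' => (p k * (1 + Real.log (p k))) * (p k' * (1 + Real.log (p k'))))
  rw [← Finset.sum_mul_sum, ← sq, ← Finset.diag_union_offDiag,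
    Finset.sum_union (Finset.disjoint_diag_offDiag _), Finset.sum_diag] at h
  rw [entropyVariance, ← h, ← sub_sub, ← Finset.sum_sub_distrib]
  congr 1
  · exact Finset.sum_congr rfl fun k _ => by ring
  · exact Finset.sum_congr rfl fun k _ => by ring

/-! ### Pathwise bounds in terms of the empirical frequencies -/

section Frequencies

variable {Ω 𝒵 : Type*} {m : ℕ} {z : Fin m → 𝒵} {Zs : ℕ → Ω → 𝒵}

lemma empPMF_nonneg (n : ℕ) (ω : Ω) (k : Fin m) : 0 ≤ empPMF z Zs n ω k :=
  mul_nonneg (by positivity)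
    (Finset.sum_nonneg fun _ _ => Set.indicator_nonneg (fun _ _ => zero_le_one) _)

lemma abs_empPMF_sub_le_supDeviation (p : Fin m → ℝ) (n : ℕ) (ω : Ω) (k : Fin m) :
    |empPMF z Zs n ω k - p k| ≤ supDeviation z Zs p n ω :=
  le_ciSup (f := fun k => |empPMF z Zs n ω k - p k|) (Set.finite_range _).bddAbove k

lemma supDeviation_nonneg (p : Fin m → ℝ) (n : ℕ) (ω : Ω) : 0 ≤ supDeviation z Zs p n ω :=
  Real.iSup_nonneg fun _ => abs_nonneg _

lemma abs_sum_negMulLog_sub_div_le (p : Fin m → ℝ) (hp : ∀ k, 0 < p k) (n : ℕ) (ω : Ω) :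
    |∑ k, Real.negMulLog (empPMF z Zs n ω k) - ∑ k, Real.negMulLog (p k)|
        / supDeviation z Zs p n ω ≤
      ∑ k, (|1 + Real.log (p k)| + |empPMF z Zs n ω k - p k| / p k) := by
  have hpos (k) : 0 ≤ |1 + Real.log (p k)| + |empPMF z Zs n ω k - p k| / p k :=
    add_nonneg (abs_nonneg _) (div_nonneg (abs_nonneg _) (hp k).le)
  -- A zero deviation is covered: the quotient is then `0` and the bound is nonnegative.
  refine div_le_of_le_mul₀ (supDeviation_nonneg _ _ _) (Finset.sum_nonneg fun k _ => hpos k) ?_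
  rw [← Finset.sum_sub_distrib, Finset.sum_mul]
  refine (Finset.abs_sum_le_sum_abs _ _).trans (Finset.sum_le_sum fun k _ => ?_)
  refine le_trans ?_ (mul_le_mul_of_nonneg_left
    (abs_empPMF_sub_le_supDeviation p n ω k) (hpos k))
  have h := abs_negMulLog_sub_add_le (hp k) (empPMF_nonneg (z := z) (Zs := Zs) n ω k)
  set q := empPMF z Zs n ω k
  have e : (|1 + Real.log (p k)| + |q - p k| / p k) * |q - p k| =
      (q - p k) ^ 2 / p k + |(1 + Real.log (p k)) * (q - p k)| := by
    rw [abs_mul, ← sq_abs (q - p k)]; ring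
  rw [e]
  calc |Real.negMulLog q - Real.negMulLog (p k)|
      = |(Real.negMulLog q - Real.negMulLog (p k) + (1 + Real.log (p k)) * (q - p k))
          - (1 + Real.log (p k)) * (q - p k)| := by rw [add_sub_cancel_right]
    _ ≤ _ := (abs_sub _ _).trans (add_le_add_left h _)

end Frequencies

lemma valuePMF_eq_of_identDistrib {Ω Ω' 𝒵 : Type*} [MeasurableSpace Ω] [MeasurableSpace Ω']
    [MeasurableSpace 𝒵] [MeasurableSingletonClass 𝒵] {P : Measure Ω} {P' : Measure Ω'} {m : ℕ}
    {z : Fin m → 𝒵} {Z : Ω → 𝒵} {Z' : Ω' → 𝒵} (h : IdentDistrib Z Z' P P') :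
    valuePMF P z Z = valuePMF P' z Z' := by
  ext k
  exact congrArg ENNReal.toReal (h.measure_mem_eq (measurableSet_singleton (z k)))

/-! ### Moments and limit theorems for the sample -/

section Sample

variable {Ω 𝒵 : Type*} [MeasurableSpace Ω] [MeasurableSpace 𝒵] [MeasurableSingletonClass 𝒵]
  {P : Measure Ω} [IsProbabilityMeasure P] {m : ℕ} {z : Fin m → 𝒵} {Zs : ℕ → Ω → 𝒵}

lemma measurable_indicator_singleton_one (a : 𝒵) :
    Measurable (({a} : Set 𝒵).indicator (fun _ => (1 : ℝ))) :=
  measurable_const.indicator (measurableSet_singleton a)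

lemma measurable_empPMF (hZs : ∀ l, Measurable (Zs l)) (n : ℕ) (k : Fin m) :
    Measurable fun ω => empPMF z Zs n ω k :=
  (Finset.measurable_fun_sum _ fun l _ =>
    (measurable_indicator_singleton_one (z k)).comp (hZs l)).const_mul _

lemma memLp_two_indicator_singleton {Z : Ω → 𝒵} (hZ : Measurable Z) (a : 𝒵) :
    MemLp (fun ω => ({a} : Set 𝒵).indicator (fun _ => (1 : ℝ)) (Z ω)) 2 P := by
  refine MemLp.of_bound
    ((measurable_indicator_singleton_one a).comp hZ).aestronglyMeasurable 1 (.of_forall fun ω => ?_)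
  exact (norm_indicator_le_norm_self _ _).trans (by simp)

omit [IsProbabilityMeasure P] in
lemma integral_indicator_singleton {Z : Ω → 𝒵} (hZ : Measurable Z) (k : Fin m) :
    ∫ ω, ({z k} : Set 𝒵).indicator (fun _ => (1 : ℝ)) (Z ω) ∂P = valuePMF P z Z k := by
  have : (fun ω => ({z k} : Set 𝒵).indicator (fun _ => (1 : ℝ)) (Z ω)) =
      (Z ⁻¹' {z k}).indicator 1 := by
    ext ω; by_cases h : Z ω = z k <;> simp [h]
  rw [this, integral_indicator_one (hZ (measurableSet_singleton _))]
  rfl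

/-- The variance of a function of a discrete variable. -/
lemma variance_sum_mul_indicator (hz : Function.Injective z) {Z : Ω → 𝒵} (hZ : Measurable Z)
    (c : Fin m → ℝ) :
    Var[fun ω => ∑ k, c k * ({z k} : Set 𝒵).indicator (fun _ => (1 : ℝ)) (Z ω); P] =
      ∑ k, valuePMF P z Z k * c k ^ 2 - (∑ k, valuePMF P z Z k * c k) ^ 2 := by
  have hL (k) := memLp_two_indicator_singleton (P := P) hZ (z k)
  have hI (k) := (hL k).integrable one_le_two
  rw [variance_eq_sub (memLp_finsetSum _ fun k _ => (hL k).const_mul (c k))]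
  -- As `z` is injective, at most one indicator is nonzero, so the cross terms vanish.
  have hsq : (fun ω => ∑ k, c k * ({z k} : Set 𝒵).indicator (fun _ => (1 : ℝ)) (Z ω)) ^ 2 =
      fun ω => ∑ k, c k ^ 2 * ({z k} : Set 𝒵).indicator (fun _ => (1 : ℝ)) (Z ω) := by
    ext ω
    simp only [Pi.pow_apply]
    by_cases h : ∃ k, Z ω = z k
    · obtain ⟨k, hk⟩ := h
      simp [hk, Set.indicator, hz.eq_iff]
    · push Not at h
      simp [Set.indicator, h]
  rw [hsq, integral_finsetSum _ fun k _ => (hI k).const_mul _,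
    integral_finsetSum _ fun k _ => (hI k).const_mul _]
  simp only [integral_const_mul, integral_indicator_singleton hZ]
  simp only [mul_comm]

lemma integrable_sq_empPMF_sub (hZs : ∀ l, Measurable (Zs l)) (n : ℕ) (k : Fin m) (p : ℝ) :
    Integrable (fun ω => (empPMF z Zs n ω k - p) ^ 2) P := by
  refine MemLp.integrable_sq (MemLp.sub ?_ (memLp_const p))
  exact (memLp_finsetSum _ fun l _ =>
    memLp_two_indicator_singleton (hZs l) (z k)).const_mul _

variable (hZs : ∀ l, Measurable (Zs l)) (hindep : iIndepFun Zs P)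
  (hident : ∀ l, IdentDistrib (Zs l) (Zs 0) P P)

include hZs hindep hident

lemma ae_tendsto_empPMF :
    ∀ᵐ ω ∂P, ∀ k, Tendsto (fun n => empPMF z Zs n ω k) atTop (𝓝 (valuePMF P z (Zs 0) k)) := by
  refine ae_all_iff.2 fun k => ?_
  have hm := measurable_indicator_singleton_one (z k)
  have := strong_law_ae_real
    (fun l ω => ({z k} : Set 𝒵).indicator (fun _ => (1 : ℝ)) (Zs l ω))
    ((memLp_two_indicator_singleton (hZs 0) (z k)).integrable one_le_two)
    (fun i j hij => (hindep.indepFun hij).comp hm hm) (fun l => (hident l).comp hm)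
  filter_upwards [this] with ω hω
  rw [integral_indicator_singleton (hZs 0)] at hω
  refine hω.congr fun n => ?_
  rw [empPMF, div_eq_inv_mul, one_div]

/-- The mean square error of an empirical frequency is at most `1 / n`. -/
lemma integral_sq_empPMF_sub_le {n : ℕ} (hn : n ≠ 0) (k : Fin m) :
    ∫ ω, (empPMF z Zs n ω k - valuePMF P z (Zs 0) k) ^ 2 ∂P ≤ 1 / n := by
  have hm := measurable_indicator_singleton_one (z k)
  have hL (l) := memLp_two_indicator_singleton (P := P) (hZs l) (z k)
  have hn' : (n : ℝ) ≠ 0 := Nat.cast_ne_zero.2 hn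
  have hmean (l) : ∫ ω, ({z k} : Set 𝒵).indicator (fun _ => (1 : ℝ)) (Zs l ω) ∂P =
      valuePMF P z (Zs 0) k := by
    rw [integral_indicator_singleton (hZs l), valuePMF_eq_of_identDistrib (hident l)]
  have hE : ∫ ω, empPMF z Zs n ω k ∂P = valuePMF P z (Zs 0) k := by
    simp only [empPMF]
    rw [integral_const_mul, integral_finsetSum _ fun l _ => (hL l).integrable one_le_two]
    simp [hmean]
    field_simp
  -- An indicator equals its square, so its second moment is a probability.
  have hv (l) : Var[fun ω => ({z k} : Set 𝒵).indicator (fun _ => (1 : ℝ)) (Zs l ω); P] ≤ 1 := by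
    refine (variance_le_expectation_sq (hL l).1).trans ?_
    have : ((fun ω => ({z k} : Set 𝒵).indicator (fun _ => (1 : ℝ)) (Zs l ω)) ^ 2 : Ω → ℝ) =
        fun ω => ({z k} : Set 𝒵).indicator (fun _ => (1 : ℝ)) (Zs l ω) := by
      ext ω; by_cases h : Zs l ω = z k <;> simp [h]
    rw [this, hmean]
    exact measureReal_le_one
  rw [← hE, ← variance_eq_integral (measurable_empPMF hZs n k).aemeasurable]
  simp only [empPMF]
  rw [variance_const_mul]
  have hs : Var[fun ω => ∑ l ∈ Finset.range n,
      ({z k} : Set 𝒵).indicator (fun _ => (1 : ℝ)) (Zs l ω); P] ≤ n := by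
    have := IndepFun.variance_sum (μ := P) (s := Finset.range n)
      (X := fun l ω => ({z k} : Set 𝒵).indicator (fun _ => (1 : ℝ)) (Zs l ω))
      (fun l _ => hL l) (fun i _ j _ hij => (hindep.indepFun hij).comp hm hm)
    rw [Finset.sum_fn] at this
    rw [this]
    exact (Finset.sum_le_sum fun l _ => hv l).trans (by simp)
  refine (mul_le_mul_of_nonneg_left hs (sq_nonneg _)).trans (le_of_eq ?_)
  field_simp

/-- The second-order remainder of the plug-in entropy is `o(n^{-1/2})` in probability. -/
lemma tendstoInMeasure_sqrt_mul_of_abs_le_sq (p : Fin m → ℝ) (hpZ : p = valuePMF P z (Zs 0))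
    (hp : ∀ k, 0 < p k) (R : ℕ → Ω → ℝ)
    (hR : ∀ n ω, |R n ω| ≤ ∑ k, (empPMF z Zs n ω k - p k) ^ 2 / p k) :
    TendstoInMeasure P (fun (n : ℕ) ω => √(n : ℝ) * R n ω) atTop 0 := by
  rw [tendstoInMeasure_iff_measureReal_norm]
  intro ε hε
  -- The Markov bound at level `ε`: each mean square error is at most `1 / n`, and `√n / n = 1 /
  -- √n`.
  have hlim : Tendsto (fun n : ℕ => (∑ k, (p k)⁻¹) / ε * (√(n : ℝ))⁻¹) atTop (𝓝 0) := by
    rw [← mul_zero ((∑ k, (p k)⁻¹) / ε)]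
    exact (tendsto_inv_atTop_zero.comp
      (Real.tendsto_sqrt_atTop.comp tendsto_natCast_atTop_atTop)).const_mul _
  refine squeeze_zero' (.of_forall fun n => measureReal_nonneg) ?_ hlim
  filter_upwards [eventually_ne_atTop 0] with n hn
  have hn0 : (0 : ℝ) < n := by positivity
  set B : Ω → ℝ := fun ω => √(n : ℝ) * ∑ k, (empPMF z Zs n ω k - p k) ^ 2 / p k with hB
  have hint (k) : Integrable (fun ω => (empPMF z Zs n ω k - p k) ^ 2 / p k) P :=
    (integrable_sq_empPMF_sub hZs n k (p k)).div_const _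
  have hBint : Integrable B P := (integrable_finsetSum _ fun k _ => hint k).const_mul _
  have hB0 : 0 ≤ B := fun ω => mul_nonneg (Real.sqrt_nonneg _)
    (Finset.sum_nonneg fun k _ => div_nonneg (sq_nonneg _) (hp k).le)
  have hEB : ∫ ω, B ω ∂P ≤ (∑ k, (p k)⁻¹) * (√(n : ℝ))⁻¹ := by
    rw [hB, integral_const_mul, integral_finsetSum _ fun k _ => hint k]
    have : ∑ k, ∫ ω, (empPMF z Zs n ω k - p k) ^ 2 / p k ∂P ≤ ∑ k, (p k)⁻¹ * (1 / n) := by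
      refine Finset.sum_le_sum fun k _ => ?_
      rw [integral_div, div_eq_inv_mul]
      refine mul_le_mul_of_nonneg_left ?_ (inv_nonneg.2 (hp k).le)
      rw [hpZ]
      exact integral_sq_empPMF_sub_le hZs hindep hident hn k
    refine (mul_le_mul_of_nonneg_left this (Real.sqrt_nonneg _)).trans (le_of_eq ?_)
    rw [← Finset.sum_mul]
    have h2 : √(n : ℝ) * (1 / n) = (√(n : ℝ))⁻¹ := by
      rw [mul_one_div, Real.sqrt_div_self', one_div]
    rw [mul_left_comm, h2]
  have hmarkov := mul_meas_ge_le_integral_of_nonneg (.of_forall hB0) hBint ε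
  have hsub : P.real {ω | ε ≤ ‖√(n : ℝ) * R n ω - (0 : Ω → ℝ) ω‖} ≤ P.real {ω | ε ≤ B ω} := by
    refine measureReal_mono fun ω hω => ?_
    simp only [Set.mem_ofPred_eq, Pi.zero_apply, sub_zero, norm_mul, Real.norm_eq_abs,
      abs_of_nonneg (Real.sqrt_nonneg _)] at hω ⊢
    exact hω.trans (mul_le_mul_of_nonneg_left (hR n ω) (Real.sqrt_nonneg _))
  refine hsub.trans ?_
  rw [div_mul_eq_mul_div, le_div_iff₀ hε, mul_comm]
  exact hmarkov.trans hEB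

/-- The central limit theorem for linear functions of the empirical frequencies. -/
lemma tendstoInDistribution_sqrt_mul_sum_empPMF_sub (hz : Function.Injective z) (c : Fin m → ℝ) :
    TendstoInDistribution
      (fun (n : ℕ) ω => √(n : ℝ) * ∑ k, c k * (empPMF z Zs n ω k - valuePMF P z (Zs 0) k))
      atTop (id : ℝ → ℝ) (fun _ => P)
      (gaussianReal 0 (∑ k, valuePMF P z (Zs 0) k * c k ^ 2
        - (∑ k, valuePMF P z (Zs 0) k * c k) ^ 2).toNNReal) := by
  set g : 𝒵 → ℝ := fun a => ∑ k, c k * ({z k} : Set 𝒵).indicator (fun _ => (1 : ℝ)) a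
  have hg : Measurable g := Finset.measurable_fun_sum _ fun k _ =>
    (measurable_indicator_singleton_one (z k)).const_mul _
  have hL (k) := memLp_two_indicator_singleton (P := P) (hZs 0) (z k)
  have hE : ∫ ω, g (Zs 0 ω) ∂P = ∑ k, c k * valuePMF P z (Zs 0) k := by
    simp only [g]
    rw [integral_finsetSum _ fun k _ => ((hL k).integrable one_le_two).const_mul _]
    simp only [integral_const_mul, integral_indicator_singleton (hZs 0)]
  have key := tendstoInDistribution_inv_sqrt_mul_sum_sub (P := P)
    (X := fun l ω => g (Zs l ω)) (Y := (id : ℝ → ℝ))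
    (P' := gaussianReal 0 Var[fun ω => g (Zs 0 ω); P].toNNReal)
    ⟨aemeasurable_id, Measure.map_id⟩
    (memLp_finsetSum _ fun k _ => (hL k).const_mul (c k))
    (hindep.comp (fun _ => g) fun _ => hg) (fun l => (hident l).comp hg)
  have hvar : Var[fun ω => g (Zs 0 ω); P] = _ := variance_sum_mul_indicator hz (hZs 0) c
  simp only [hvar] at key
  convert key using 3 with n ω
  rcases eq_or_ne n 0 with rfl | hn
  · simp
  have hn0 : (0 : ℝ) < n := by positivity
  -- The factor `1 / n` in the frequencies and `√n` combine to the normalisation `1 / √n` of the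
  -- central limit theorem for `g (Z_l)`.
  have h1 : ∑ k, c k * (empPMF z Zs n ω k - valuePMF P z (Zs 0) k) =
      (1 / (n : ℝ)) * (∑ l ∈ Finset.range n, g (Zs l ω) - n * ∫ ω, g (Zs 0 ω) ∂P) := by
    rw [hE, mul_sub, ← mul_assoc, one_div_mul_cancel hn0.ne', one_mul]
    simp only [g, mul_sub, Finset.sum_sub_distrib]
    rw [Finset.sum_comm, Finset.mul_sum]
    congr 1
    refine Finset.sum_congr rfl fun k _ => ?_
    rw [empPMF, ← Finset.mul_sum]
    ring
  rw [h1, ← mul_assoc, mul_one_div, Real.sqrt_div_self', one_div]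

end Sample

theorem theorem1
    {Ω Ω' 𝒳 𝒴 𝒵 : Type*} [MeasurableSpace Ω] [MeasurableSpace Ω']
    [MeasurableSpace 𝒳] [MeasurableSingletonClass 𝒳]
    [MeasurableSpace 𝒴] [MeasurableSingletonClass 𝒴]
    [MeasurableSpace 𝒵] [MeasurableSingletonClass 𝒵]
    (P : Measure Ω) [IsProbabilityMeasure P] (P' : Measure Ω') [IsProbabilityMeasure P']
    (r s : ℕ)
    -- the possible values, listed without repetition
    (x : Fin r → 𝒳) (hx : Function.Injective x)
    (y : Fin s → 𝒴) (hy : Function.Injective y)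
    (z : Fin (r * s) → 𝒵) (hz : Function.Injective z)
    -- the pair of discrete random variables
    (X : Ω → 𝒳) (hX : Measurable X) (hXval : ∀ᵐ ω ∂P, X ω ∈ Set.range x)
    (Y : Ω → 𝒴) (hY : Measurable Y) (hYval : ∀ᵐ ω ∂P, Y ω ∈ Set.range y)
    -- the associated variable
    (Z : Ω → 𝒵) (hZ : Measurable Z)
    (hZassoc : ∀ i j, valuePMF P z Z (pairIndex i j) = jointPMF P x y X Y i j)
    (hBD : ∀ k, 0 < valuePMF P z Z k)
    -- the i.i.d. sample
    (Zs : ℕ → Ω' → 𝒵) (hZs : ∀ l, Measurable (Zs l))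
    (hindep : iIndepFun Zs P') (hident : ∀ l, IdentDistrib (Zs l) Z P' P) :
    (∀ᵐ ω ∂P',
      limsup (fun n : ℕ =>
        ((|plugInEntropy (r := r) (s := s) z Zs n ω - jointEntropy (jointPMF P x y X Y)|
          / supDeviation z Zs (valuePMF P z Z) n ω : ℝ) : EReal)) atTop
        ≤ (entropyRateConst (valuePMF P z Z) : EReal)) ∧
    0 ≤ entropyVariance (valuePMF P z Z) ∧
    TendstoInDistribution
      (fun (n : ℕ) ω => √(n : ℝ) *
        (plugInEntropy (r := r) (s := s) z Zs n ω - jointEntropy (jointPMF P x y X Y)))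
      atTop (id : ℝ → ℝ) (fun _ => P')
      (gaussianReal 0 (entropyVariance (valuePMF P z Z)).toNNReal) := by
  set p := valuePMF P z Z with hpdef
  have hpZ : p = valuePMF P' z (Zs 0) := (valuePMF_eq_of_identDistrib (hident 0)).symm
  have hident' : ∀ l, IdentDistrib (Zs l) (Zs 0) P' P' := fun l => (hident l).trans (hident 0).symm
  have hjoint : jointEntropy (jointPMF P x y X Y) = ∑ k, Real.negMulLog (p k) := by
    rw [← jointEntropy_pairIndex]
    congr 1
    ext i j
    exact (hZassoc i j).symm
  have hplug (n ω) : plugInEntropy (r := r) (s := s) z Zs n ω =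
      ∑ k, Real.negMulLog (empPMF z Zs n ω k) := jointEntropy_pairIndex _
  simp only [hjoint, hplug]
  -- The coefficients of the linear part are `h' (p_k)`; their common sign does not affect the
  -- variance.
  have hvar : entropyVariance p = ∑ k, p k * (-(1 + Real.log (p k))) ^ 2
      - (∑ k, p k * -(1 + Real.log (p k))) ^ 2 := by
    rw [entropyVariance_eq]
    simp only [neg_sq, mul_neg, Finset.sum_neg_distrib]
  refine ⟨?_, ?_, ?_⟩
  · filter_upwards [ae_tendsto_empPMF (z := z) hZs hindep hident'] with ω hω
    rw [← hpZ] at hω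
    have hlim : Tendsto
        (fun n => ∑ k, (|1 + Real.log (p k)| + |empPMF z Zs n ω k - p k| / p k)) atTop
        (𝓝 (entropyRateConst p)) := by
      refine tendsto_finsetSum _ fun k _ => ?_
      simpa using (((hω k).sub_const (p k)).abs.div_const (p k)).const_add |1 + Real.log (p k)|
    rw [← ((continuous_coe_real_ereal.tendsto _).comp hlim).limsup_eq]
    exact limsup_le_limsup (.of_forall fun n =>
      EReal.coe_le_coe_iff.2 (abs_sum_negMulLog_sub_div_le p hBD n ω))
  · rw [hvar, hpdef, ← variance_sum_mul_indicator hz hZ]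
    exact variance_nonneg _ _
  · have hclt := tendstoInDistribution_sqrt_mul_sum_empPMF_sub hZs hindep hident' hz
      (fun k => -(1 + Real.log (p k)))
    simp only [← hpZ, ← hvar] at hclt
    -- Slutsky: the difference from the linear part is `√n R_n`.
    refine tendstoInDistribution_of_tendstoInMeasure_sub _ _ hclt ?_ fun n => ?_
    · refine (tendstoInMeasure_sqrt_mul_of_abs_le_sq hZs hindep hident' p hpZ hBD
        (fun n ω => ∑ k, (Real.negMulLog (empPMF z Zs n ω k) - Real.negMulLog (p k)
          + (1 + Real.log (p k)) * (empPMF z Zs n ω k - p k))) fun n ω => ?_).congr_left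
        fun n => .of_forall fun ω => ?_
      · exact (Finset.abs_sum_le_sum_abs _ _).trans (Finset.sum_le_sum fun k _ =>
          abs_negMulLog_sub_add_le (hBD k) (empPMF_nonneg n ω k))
      · simp only [Pi.sub_apply, Finset.sum_add_distrib, Finset.sum_sub_distrib, neg_mul,
          Finset.sum_neg_distrib]
        ring
    · exact (((Finset.measurable_fun_sum _ fun k _ => Real.continuous_negMulLog.measurable.comp
        (measurable_empPMF hZs n k)).sub_const _).const_mul _).aemeasurable
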